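/- Let $n\ge 0$ and let $G=\mathrm{PSL}(n+1,\mathbb C)$ act on $\mathbb P^n=\mathbb P^n_{\mathbb C}$ by projective transformations $L_g$, $g\in G$. Let $(\mathbb P^n)^{(2)}$ be the total space of the bundle $J^1(T\mathbb P^n)$ of $1$-jets of local holomorphic vector fields on $\mathbb P^n$, an algebraic variety of dimension $n^2+2n$. Each $L_g$ induces a prolonged map $L_g^{(2)}\colon(\mathbb P^n)^{(2)}\to(\mathbb P^n)^{(2)}$, which sends the $1$-jet at $x$ of a vector field $s$ to the $1$-jet at $L_g(x)$ of the vector field $s'$ with $dL_g\circ s=s'\circ L_g$; this defines an action $g\cdot q:=L_g^{(2)}(q)$ of $G$ on $(\mathbb P^n)^{(2)}$. Then for a generic point $q\in(\mathbb P^n)^{(2)}$ the isotropy group $G_q=\{g\in G:\ g\cdot q=q\}$ is trivial; that is, there is a dense Zariski open subset $U\subset(\mathbb P^n)^{(2)}$ such that $G_q=\{1\}$ for every $q\in U$. -/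

import Mathlib

open scoped Manifold ContDiff LinearAlgebra.Projectivization MatrixGroups

noncomputable section

/-! ### One-jets of holomorphic vector fields on a complex manifold -/

section Jets

variable {E : Type*} [NormedAddCommGroup E] [NormedSpace ℂ E]
  {M : Type*} [TopologicalSpace M] [ChartedSpace E M] [IsManifold 𝓘(ℂ, E) ω M]

variable (E M) in
/-- A germ of holomorphic vector field on the complex manifold `M`, given by a representative:
a point `base`, and a section `field` of the tangent bundle which is holomorphic on some
neighbourhood of `base`. (The values of `field` away from `base` are irrelevant for jets.) -/
structure HolVectorFieldGerm where
  base : M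
  field : M → TangentBundle 𝓘(ℂ, E) M
  proj_field : ∀ y, (field y).proj = y
  holo : ContMDiffAt 𝓘(ℂ, E) 𝓘(ℂ, E).tangent ω field base

/-- The components of a section `s` of the tangent bundle in the coordinate frame of a coordinate
system `e`: the vector-valued function `f` of the coordinates with `s = ∑ f_j ∂/∂x_j`, i.e.
`f_j = dx_j (s)`. -/
def coordComponents (e : OpenPartialHomeomorph M E) (s : M → TangentBundle 𝓘(ℂ, E) M) : E → E :=
  fun u => (tangentMap 𝓘(ℂ, E) 𝓘(ℂ, E) e (s (e.symm u))).snd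

variable (E M) in
/-- Two germs of vector fields have the same `1`-jet if they are based at the same point `x` and
their components, in the coordinate systems of the atlas around `x`, have the same value and the
same first derivatives at `x`. -/
instance oneJetSetoid : Setoid (HolVectorFieldGerm E M) where
  r s t := s.base = t.base ∧ ∀ e ∈ atlas E M, s.base ∈ e.source →
    coordComponents e s.field (e s.base) = coordComponents e t.field (e s.base) ∧
    fderiv ℂ (coordComponents e s.field) (e s.base) =
      fderiv ℂ (coordComponents e t.field) (e s.base)
  iseqv :=
    { refl := fun _ => ⟨rfl, fun _ _ _ => ⟨rfl, rfl⟩⟩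
      symm := fun {s t} h => ⟨h.1.symm, fun e he hx => by
        have := h.2 e he (by rw [h.1]; exact hx)
        rw [h.1] at this
        exact ⟨this.1.symm, this.2.symm⟩⟩
      trans := fun {s t r} h k => ⟨h.1.trans k.1, fun e he hx => by
        have h1 := h.2 e he hx
        have k1 := k.2 e he (by rw [← h.1]; exact hx)
        rw [← h.1] at k1
        exact ⟨h1.1.trans k1.1, h1.2.trans k1.2⟩⟩ }

variable (E M) in
/-- The total space of the bundle `J¹(TM)` of `1`-jets of holomorphic vector fields on `M`, that is
the second prolongation `M^{(2)}` of `M`. -/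
def OneJetTangent : Type _ := Quotient (oneJetSetoid E M)

namespace OneJetTangent

/-- The `1`-jet of a germ of vector field at its base point. -/
def mk (s : HolVectorFieldGerm E M) : OneJetTangent E M := Quotient.mk _ s

/-- The bundle projection `J¹(TM) → M`. -/
def proj : OneJetTangent E M → M := Quotient.lift HolVectorFieldGerm.base fun _ _ h => h.1

end OneJetTangent

/-- The germ `s'` with `dφ ∘ s = s' ∘ φ`, based at `φ x` when `s` is based at `x`. -/
def HolVectorFieldGerm.push (φ : M ≃ₘ^ω⟮𝓘(ℂ, E), 𝓘(ℂ, E)⟯ M) (s : HolVectorFieldGerm E M) :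
    HolVectorFieldGerm E M where
  base := φ s.base
  field := fun y => tangentMap 𝓘(ℂ, E) 𝓘(ℂ, E) φ (s.field (φ.symm y))
  proj_field := fun y => by
    rw [tangentMap_proj, s.proj_field, φ.apply_symm_apply]
  holo := by
    have h1 : ContMDiff 𝓘(ℂ, E).tangent 𝓘(ℂ, E).tangent ω (tangentMap 𝓘(ℂ, E) 𝓘(ℂ, E) φ) :=
      φ.contMDiff.contMDiff_tangentMap le_top
    have h2 : ContMDiffAt 𝓘(ℂ, E) 𝓘(ℂ, E).tangent ω s.field (φ.symm (φ s.base)) := by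
      rw [φ.symm_apply_apply]; exact s.holo
    exact h1.contMDiffAt.comp _ (h2.comp _ φ.symm.contMDiff.contMDiffAt)

theorem differentiableAt_coordComponents (s : HolVectorFieldGerm E M) :
    DifferentiableAt ℂ (coordComponents (chartAt E s.base) s.field)
      (chartAt E s.base s.base) := by
  have h := (Bundle.contMDiffAt_totalSpace.1 s.holo).2
  rw [s.proj_field] at h
  have hs : ContMDiffAt 𝓘(ℂ, E) 𝓘(ℂ, E) ω (chartAt E s.base).symm (chartAt E s.base s.base) :=
    (contMDiffOn_chart_symm (I := 𝓘(ℂ, E)) (n := ω) (x := s.base)).contMDiffAt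
      ((chartAt E s.base).open_target.mem_nhds (mem_chart_target E s.base))
  have hl : (chartAt E s.base).symm (chartAt E s.base s.base) = s.base :=
    (chartAt E s.base).left_inv (mem_chart_source E s.base)
  have h2 := ContMDiffAt.comp (chartAt E s.base s.base) (by rw [hl]; exact h) hs
  have h3 := (contMDiffAt_iff_contDiffAt.1 h2).differentiableAt (by simp)
  refine h3.congr_of_eventuallyEq ?_
  filter_upwards [(chartAt E s.base).open_target.mem_nhds (mem_chart_target E s.base)] with u hu
  have hp : (s.field ((chartAt E s.base).symm u)).proj ∈ (chartAt E s.base).source := by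
    rw [s.proj_field]; exact (chartAt E s.base).map_target hu
  simp only [coordComponents, Function.comp]
  have := tangentMap_chart (I := 𝓘(ℂ, E)) (p := ⟨s.base, (0 : E)⟩)
    (q := s.field ((chartAt E s.base).symm u)) hp
  simp only at this
  rw [this]
  rfl

theorem coordComponents_push (φ : M ≃ₘ^ω⟮𝓘(ℂ, E), 𝓘(ℂ, E)⟯ M) (s : HolVectorFieldGerm E M)
    {e e' : OpenPartialHomeomorph M E} (he : e ∈ atlas E M) (he' : e' ∈ atlas E M)
    {u : E} (hu : u ∈ e'.target) (hy : φ.symm (e'.symm u) ∈ e.source) :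
    coordComponents e' (s.push φ).field u =
      fderiv ℂ (e' ∘ φ ∘ e.symm) (e (φ.symm (e'.symm u)))
        (coordComponents e s.field (e (φ.symm (e'.symm u)))) := by
  set y := φ.symm (e'.symm u) with hydef
  have hφy : φ y = e'.symm u := by simp [hydef]
  have hme : MDifferentiableAt 𝓘(ℂ, E) 𝓘(ℂ, E) e y := mdifferentiableAt_atlas he hy
  have hmes : MDifferentiableAt 𝓘(ℂ, E) 𝓘(ℂ, E) e.symm (e y) :=
    mdifferentiableAt_atlas_symm he (e.map_source hy)
  have hmφ : MDifferentiableAt 𝓘(ℂ, E) 𝓘(ℂ, E) φ y :=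
    φ.contMDiff.contMDiffAt.mdifferentiableAt (by simp)
  have hme' : MDifferentiableAt 𝓘(ℂ, E) 𝓘(ℂ, E) e' (φ y) :=
    mdifferentiableAt_atlas he' (by rw [hφy]; exact e'.map_target hu)
  have hl : e.symm (e y) = y := e.left_inv hy
  have hpr := s.proj_field y
  have e1 : coordComponents e s.field (e y) =
      (tangentMap 𝓘(ℂ, E) 𝓘(ℂ, E) e (s.field y)).snd := by
    unfold coordComponents
    rw [hl]
  rw [e1]
  change (tangentMap 𝓘(ℂ, E) 𝓘(ℂ, E) e' (tangentMap 𝓘(ℂ, E) 𝓘(ℂ, E) φ (s.field y))).snd = _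
  clear_value y
  clear e1 hydef
  generalize s.field y = v at hpr ⊢
  obtain ⟨p, v⟩ := v
  change p = y at hpr
  subst hpr
  rw [← mfderiv_eq_fderiv]
  have h1 : e.symm (e p) = p := hl
  have hsy : MDifferentiableAt 𝓘(ℂ, E) 𝓘(ℂ, E) φ (e.symm (e p)) := by rw [h1]; exact hmφ
  have h2 : MDifferentiableAt 𝓘(ℂ, E) 𝓘(ℂ, E) e' ((φ ∘ e.symm) (e p)) := by
    simp only [Function.comp, h1]; exact hme'
  have hcomp : MDifferentiableAt 𝓘(ℂ, E) 𝓘(ℂ, E) (e' ∘ φ ∘ e.symm) (e p) :=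
    h2.comp _ (hsy.comp _ hmes)
  have key : (e' ∘ φ) =ᶠ[nhds p] ((e' ∘ φ ∘ e.symm) ∘ e) := by
    filter_upwards [e.open_source.mem_nhds hy] with z hz
    simp [e.left_inv hz]
  have k2 : mfderiv 𝓘(ℂ, E) 𝓘(ℂ, E) (e' ∘ φ) p v =
      mfderiv 𝓘(ℂ, E) 𝓘(ℂ, E) ((e' ∘ φ ∘ e.symm) ∘ e) p v := by
    rw [key.mfderiv_eq]
    rfl
  rw [mfderiv_comp p hcomp hme, mfderiv_comp p hme' hmφ] at k2
  exact k2

theorem coordComponents_push_hasFDerivAt (φ : M ≃ₘ^ω⟮𝓘(ℂ, E), 𝓘(ℂ, E)⟯ M)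
    (s : HolVectorFieldGerm E M)
    {e' : OpenPartialHomeomorph M E} (he' : e' ∈ atlas E M) (hx : φ s.base ∈ e'.source) :
    let e := chartAt E s.base
    let F := e' ∘ φ ∘ e.symm
    let x := e s.base
    coordComponents e' (s.push φ).field (e' (φ s.base)) =
        fderiv ℂ F x (coordComponents e s.field x) ∧
    HasFDerivAt (coordComponents e' (s.push φ).field)
      ((fderiv ℂ F x ∘L fderiv ℂ (coordComponents e s.field) x +
        (fderiv ℂ (fderiv ℂ F) x).flip (coordComponents e s.field x)) ∘L
          fderiv ℂ (e ∘ φ.symm ∘ e'.symm) (e' (φ s.base))) (e' (φ s.base)) := by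
  intro e F x
  have he : e ∈ atlas E M := chart_mem_atlas E s.base
  have hb : s.base ∈ e.source := mem_chart_source E s.base
  have hback : φ.symm (e'.symm (e' (φ s.base))) = s.base := by
    rw [e'.left_inv hx, φ.symm_apply_apply]
  have hl : e.symm x = s.base := e.left_inv hb
  constructor
  · have := coordComponents_push φ s he he' (e'.map_source hx) (by rw [hback]; exact hb)
    rw [hback] at this
    exact this
  -- smoothness of the two coordinate expressions
  have hFs : ContDiffAt ℂ ω F x := by
    rw [← contMDiffAt_iff_contDiffAt]
    have a1 : ContMDiffAt 𝓘(ℂ, E) 𝓘(ℂ, E) ω e.symm x :=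
      (contMDiffOn_symm_of_mem_maximalAtlas (IsManifold.subset_maximalAtlas he)).contMDiffAt
        (e.open_target.mem_nhds (e.map_source hb))
    have a2 : ContMDiffAt 𝓘(ℂ, E) 𝓘(ℂ, E) ω e' ((φ ∘ e.symm) x) :=
      (contMDiffOn_of_mem_maximalAtlas (IsManifold.subset_maximalAtlas he')).contMDiffAt
        (e'.open_source.mem_nhds (by simp only [Function.comp, hl]; exact hx))
    exact a2.comp _ (φ.contMDiff.contMDiffAt.comp _ a1)
  have hHs : ContDiffAt ℂ ω (e ∘ φ.symm ∘ e'.symm) (e' (φ s.base)) := by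
    rw [← contMDiffAt_iff_contDiffAt]
    have a1 : ContMDiffAt 𝓘(ℂ, E) 𝓘(ℂ, E) ω e'.symm (e' (φ s.base)) :=
      (contMDiffOn_symm_of_mem_maximalAtlas (IsManifold.subset_maximalAtlas he')).contMDiffAt
        (e'.open_target.mem_nhds (e'.map_source hx))
    have a2 : ContMDiffAt 𝓘(ℂ, E) 𝓘(ℂ, E) ω e ((φ.symm ∘ e'.symm) (e' (φ s.base))) :=
      (contMDiffOn_of_mem_maximalAtlas (IsManifold.subset_maximalAtlas he)).contMDiffAt
        (e.open_source.mem_nhds (by simp only [Function.comp, hback]; exact hb))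
    exact a2.comp _ (φ.symm.contMDiff.contMDiffAt.comp _ a1)
  have hHx : (e ∘ φ.symm ∘ e'.symm) (e' (φ s.base)) = x := by
    simp only [Function.comp, hback]; rfl
  have hF' : DifferentiableAt ℂ (fderiv ℂ F) x :=
    (hFs.fderiv_right (m := 1) le_top).differentiableAt (by simp)
  have hc := differentiableAt_coordComponents s
  have hprod : HasFDerivAt (fun w => fderiv ℂ F w (coordComponents e s.field w))
      (fderiv ℂ F x ∘L fderiv ℂ (coordComponents e s.field) x +
        (fderiv ℂ (fderiv ℂ F) x).flip (coordComponents e s.field x)) x :=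
    hF'.hasFDerivAt.clm_apply hc.hasFDerivAt
  rw [← hHx] at hprod
  have hcomp := hprod.comp (e' (φ s.base)) (hHs.differentiableAt (by simp)).hasFDerivAt
  rw [hHx] at hcomp
  refine hcomp.congr_of_eventuallyEq ?_
  have n1 : ∀ᶠ u in nhds (e' (φ s.base)), u ∈ e'.target :=
    e'.open_target.mem_nhds (e'.map_source hx)
  have n2 : ∀ᶠ u in nhds (e' (φ s.base)), φ.symm (e'.symm u) ∈ e.source := by
    have : ContinuousAt (fun u => φ.symm (e'.symm u)) (e' (φ s.base)) :=
      φ.symm.contMDiff.continuous.continuousAt.comp (e'.continuousAt_symm (e'.map_source hx))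
    apply this.eventually_mem
    apply e.open_source.mem_nhds
    rw [hback]; exact hb
  filter_upwards [n1, n2] with u h1 h2
  exact coordComponents_push φ s he he' h1 h2

namespace OneJetTangent

/-- The (first) prolongation `(dφ)^{(1)} : J¹(TM) → J¹(TM)` of the push-forward of vector fields by
a biholomorphism `φ`: it sends the `1`-jet of `s` at `x` to the `1`-jet at `φ x` of the vector
field `s'` such that `dφ ∘ s = s' ∘ φ`. -/
def prolong (φ : M ≃ₘ^ω⟮𝓘(ℂ, E), 𝓘(ℂ, E)⟯ M) : OneJetTangent E M → OneJetTangent E M :=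
  Quotient.map (HolVectorFieldGerm.push φ) fun s t h => by
    refine ⟨congrArg φ h.1, fun e' he' hx => ?_⟩
    have hx' : φ t.base ∈ e'.source := by rw [← h.1]; exact hx
    obtain ⟨s0, s1⟩ := coordComponents_push_hasFDerivAt φ s he' hx
    obtain ⟨t0, t1⟩ := coordComponents_push_hasFDerivAt φ t he' hx'
    obtain ⟨h0, h1⟩ := h.2 _ (chart_mem_atlas E s.base) (mem_chart_source E s.base)
    rw [← h.1] at t0 t1
    have eb : (s.push φ).base = φ s.base := rfl
    rw [eb]
    constructor
    · rw [s0, t0, h0]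
    · rw [s1.fderiv, t1.fderiv, h0, h1]

theorem prolong_mk (φ : M ≃ₘ^ω⟮𝓘(ℂ, E), 𝓘(ℂ, E)⟯ M) (s : HolVectorFieldGerm E M) :
    prolong φ (mk s) = mk (s.push φ) := rfl

theorem prolong_eq_self (φ : M ≃ₘ^ω⟮𝓘(ℂ, E), 𝓘(ℂ, E)⟯ M) (h : ∀ x, φ x = x)
    (q : OneJetTangent E M) : prolong φ q = q := by
  induction q using Quotient.ind with | _ s =>
  change mk (s.push φ) = mk s
  have hid : (φ : M → M) = id := funext h
  have hs : ∀ y, φ.symm y = y := fun y => by rw [← h (φ.symm y), φ.apply_symm_apply]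
  congr 1
  cases s
  simp only [HolVectorFieldGerm.push, HolVectorFieldGerm.mk.injEq]
  refine ⟨h _, funext fun y => ?_⟩
  rw [hid, tangentMap_id, hs]; rfl

theorem prolong_comp (φ ψ χ : M ≃ₘ^ω⟮𝓘(ℂ, E), 𝓘(ℂ, E)⟯ M) (h : ∀ x, χ x = φ (ψ x))
    (q : OneJetTangent E M) : prolong χ q = prolong φ (prolong ψ q) := by
  induction q using Quotient.ind with | _ s =>
  change mk (s.push χ) = mk ((s.push ψ).push φ)
  have hc : (χ : M → M) = φ ∘ ψ := funext h
  have hs : ∀ y, χ.symm y = ψ.symm (φ.symm y) := fun y => by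
    apply χ.injective
    change χ _ = χ _
    rw [χ.apply_symm_apply, h, ψ.apply_symm_apply, φ.apply_symm_apply]
  congr 1
  simp only [HolVectorFieldGerm.push, HolVectorFieldGerm.mk.injEq]
  refine ⟨h _, funext fun y => ?_⟩
  rw [hc, tangentMap_comp (φ.contMDiff.mdifferentiable (by simp))
    (ψ.contMDiff.mdifferentiable (by simp)), hs]
  rfl

end OneJetTangent

end Jets

/-! ### Complex projective space as a complex manifold -/

/-- Complex projective space `ℙⁿ`. -/
abbrev ProjSpace (n : ℕ) : Type := ℙ ℂ (Fin (n + 1) → ℂ)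

namespace ProjSpace

variable {n : ℕ}

/-- The quotient topology of `ℂⁿ⁺¹ ∖ {0}`. -/
instance : TopologicalSpace (ProjSpace n) :=
  inferInstanceAs (TopologicalSpace
    (Quotient (projectivizationSetoid ℂ (Fin (n + 1) → ℂ))))

/-- The affine open subset `x_i ≠ 0`. -/
def affineOpen (i : Fin (n + 1)) : Set (ProjSpace n) :=
  {p | Projectivization.lift (fun v : {v : Fin (n + 1) → ℂ // v ≠ 0} => v.1 i ≠ 0) (by
    rintro ⟨a, ha⟩ ⟨b, hb⟩ t rfl
    have ht : t ≠ 0 := by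
      rintro rfl
      simp at ha
    simp [ht]) p}

theorem mk_mem_affineOpen (i : Fin (n + 1)) (v : Fin (n + 1) → ℂ) (hv : v ≠ 0) :
    Projectivization.mk ℂ v hv ∈ affineOpen i ↔ v i ≠ 0 := Iff.rfl

/-- The affine coordinates `x_j / x_i`, `j ≠ i`. -/
def affineCoord (i : Fin (n + 1)) (p : ProjSpace n) : Fin n → ℂ :=
  Projectivization.lift (fun (v : {v : Fin (n + 1) → ℂ // v ≠ 0}) j => v.1 (i.succAbove j) / v.1 i) (by
    rintro ⟨a, ha⟩ ⟨b, hb⟩ t rfl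
    have ht : t ≠ 0 := by
      rintro rfl
      simp at ha
    funext j
    simp [mul_div_mul_left _ _ ht]) p

theorem affineCoord_mk (i : Fin (n + 1)) (v : Fin (n + 1) → ℂ) (hv : v ≠ 0) (j : Fin n) :
    affineCoord i (Projectivization.mk ℂ v hv) j = v (i.succAbove j) / v i := rfl

theorem insertNth_one_ne_zero (i : Fin (n + 1)) (u : Fin n → ℂ) :
    (i.insertNth (1 : ℂ) u : Fin (n + 1) → ℂ) ≠ 0 := fun h => by
  have := congrFun h i
  simp at this

/-- The point with affine coordinates `u` in the affine open subset `x_i ≠ 0`, i.e. the point with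
homogeneous coordinates `(u_1 : ⋯ : 1 : ⋯ : u_n)`, with `1` in position `i`. -/
def affinePoint (i : Fin (n + 1)) (u : Fin n → ℂ) : ProjSpace n :=
  Projectivization.mk ℂ (i.insertNth (1 : ℂ) u) (insertNth_one_ne_zero i u)

theorem continuous_insertNth_one (i : Fin (n + 1)) :
    Continuous fun u : Fin n → ℂ => (i.insertNth (1 : ℂ) u : Fin (n + 1) → ℂ) :=
  continuous_const.finInsertNth i continuous_id

theorem continuous_affinePoint (i : Fin (n + 1)) : Continuous (affinePoint (n := n) i) :=
  (continuous_quotient_mk' (s := projectivizationSetoid ℂ (Fin (n + 1) → ℂ))).comp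
    ((continuous_insertNth_one i).subtype_mk (insertNth_one_ne_zero i))

theorem isOpen_affineOpen (i : Fin (n + 1)) : IsOpen (affineOpen (n := n) i) := by
  have hq := isQuotientMap_quotient_mk' (s := projectivizationSetoid ℂ (Fin (n + 1) → ℂ))
  apply hq.isOpen_preimage.1
  change IsOpen {v : {v : Fin (n + 1) → ℂ // v ≠ 0} | v.1 i ≠ 0}
  exact isOpen_ne.preimage ((continuous_apply i).comp continuous_subtype_val)

theorem continuousOn_affineCoord (i : Fin (n + 1)) :
    ContinuousOn (affineCoord (n := n) i) (affineOpen i) := by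
  have hq := isQuotientMap_quotient_mk' (s := projectivizationSetoid ℂ (Fin (n + 1) → ℂ))
  refine (hq.continuousOn_isOpen_iff (isOpen_affineOpen i)).2 ?_
  refine continuousOn_pi.2 fun j => ?_
  change ContinuousOn (fun v : {v : Fin (n + 1) → ℂ // v ≠ 0} => v.1 (i.succAbove j) / v.1 i)
    {v | v.1 i ≠ 0}
  exact (((continuous_apply _).comp continuous_subtype_val).continuousOn).div
    (((continuous_apply _).comp continuous_subtype_val).continuousOn) fun v hv => hv

theorem affinePoint_affineCoord (i : Fin (n + 1)) {p : ProjSpace n} (hp : p ∈ affineOpen i) :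
    affinePoint i (affineCoord i p) = p := by
  induction p using Projectivization.ind with | h v hv =>
  have hv' : v i ≠ 0 := hp
  refine (Projectivization.mk_eq_mk_iff' ℂ _ _ _ _).2 ⟨(v i)⁻¹, ?_⟩
  funext k
  refine Fin.succAboveCases i ?_ (fun j => ?_) k
  · simp [hv']
  · simp [affineCoord_mk, div_eq_inv_mul]

theorem affinePoint_mem (i : Fin (n + 1)) (u : Fin n → ℂ) : affinePoint i u ∈ affineOpen i := by
  rw [affinePoint, mk_mem_affineOpen]
  simp

theorem affineCoord_affinePoint (i : Fin (n + 1)) (u : Fin n → ℂ) :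
    affineCoord i (affinePoint i u) = u := by
  funext j
  simp [affinePoint, affineCoord_mk]

/-- The standard affine chart `x_i ≠ 0` of projective space. -/
def affineChart (i : Fin (n + 1)) : OpenPartialHomeomorph (ProjSpace n) (Fin n → ℂ) where
  toFun := affineCoord i
  invFun := affinePoint i
  source := affineOpen i
  target := Set.univ
  map_source' _ _ := Set.mem_univ _
  map_target' u _ := affinePoint_mem i u
  left_inv' _ hp := affinePoint_affineCoord i hp
  right_inv' u _ := affineCoord_affinePoint i u
  open_source := isOpen_affineOpen i
  open_target := isOpen_univ
  continuousOn_toFun := continuousOn_affineCoord i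
  continuousOn_invFun := (continuous_affinePoint i).continuousOn

theorem exists_mem_affineOpen (p : ProjSpace n) : ∃ i, p ∈ affineOpen i := by
  induction p using Projectivization.ind with | h v hv =>
  obtain ⟨i, hi⟩ := Function.ne_iff.1 hv
  exact ⟨i, hi⟩

/-- Projective space with its atlas of `n + 1` standard affine charts. -/
instance : ChartedSpace (Fin n → ℂ) (ProjSpace n) where
  atlas := Set.range affineChart
  chartAt p := affineChart (exists_mem_affineOpen p).choose
  mem_chart_source p := (exists_mem_affineOpen p).choose_spec
  chart_mem_atlas _ := Set.mem_range_self _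

theorem affineChart_mem_atlas (i : Fin (n + 1)) :
    affineChart i ∈ atlas (Fin n → ℂ) (ProjSpace n) := Set.mem_range_self i

theorem contDiff_insertNth_one (i : Fin (n + 1)) :
    ContDiff ℂ ω fun u : Fin n → ℂ => (i.insertNth (1 : ℂ) u : Fin (n + 1) → ℂ) := by
  refine contDiff_pi.2 fun k => ?_
  refine Fin.succAboveCases i ?_ (fun j => ?_) k
  · simpa using contDiff_const
  · simpa using contDiff_apply ℂ ℂ j

instance : IsManifold 𝓘(ℂ, Fin n → ℂ) ω (ProjSpace n) := by
  refine isManifold_of_contDiffOn _ _ _ ?_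
  rintro _ _ ⟨i, rfl⟩ ⟨k, rfl⟩
  refine contDiffOn_pi.2 fun j => ?_
  have h : ContDiffOn ℂ ω (fun u : Fin n → ℂ =>
      (i.insertNth (1 : ℂ) u : Fin (n + 1) → ℂ) (k.succAbove j) /
        (i.insertNth (1 : ℂ) u : Fin (n + 1) → ℂ) k)
      {u | (i.insertNth (1 : ℂ) u : Fin (n + 1) → ℂ) k ≠ 0} :=
    ((contDiff_pi.1 (contDiff_insertNth_one i) _).contDiffOn).div
      ((contDiff_pi.1 (contDiff_insertNth_one i) _).contDiffOn) fun u hu => hu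
  refine h.mono ?_
  rintro u ⟨⟨_, hu⟩, _⟩
  exact hu

theorem contMDiff_smul_SL (g : SL(n + 1, ℂ)) :
    ContMDiff 𝓘(ℂ, Fin n → ℂ) 𝓘(ℂ, Fin n → ℂ) ω (fun p : ProjSpace n => g • p) := by
  intro p
  obtain ⟨i, hi⟩ := exists_mem_affineOpen p
  obtain ⟨k, hk⟩ := exists_mem_affineOpen (g • p)
  let L : (Fin n → ℂ) → Fin (n + 1) → ℂ := fun u =>
    (g : Matrix (Fin (n + 1)) (Fin (n + 1)) ℂ).mulVec (i.insertNth (1 : ℂ) u)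
  have hL : ∀ m, ContDiff ℂ ω fun u => L u m := fun m => by
    change ContDiff ℂ ω fun u : Fin n → ℂ => ∑ j, g.1 m j * (i.insertNth (1 : ℂ) u : Fin (n + 1) → ℂ) j
    refine ContDiff.sum fun j _ => ?_
    exact contDiff_const.mul (contDiff_pi.1 (contDiff_insertNth_one i) j)
  have hgp : ∀ u, ∃ h : L u ≠ 0, g • affinePoint i u = Projectivization.mk ℂ (L u) h :=
    fun u => ⟨(smul_ne_zero_iff_ne g).mpr (insertNth_one_ne_zero i u), rfl⟩
  let F : (Fin n → ℂ) → Fin n → ℂ := fun u j => L u (k.succAbove j) / L u k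
  have hLk : L (affineCoord i p) k ≠ 0 := by
    obtain ⟨h, e⟩ := hgp (affineCoord i p)
    rw [affinePoint_affineCoord i hi] at e
    rw [e] at hk
    exact hk
  have hF : ContDiffAt ℂ ω F (affineCoord i p) :=
    contDiffAt_pi.2 fun j => (hL _).contDiffAt.div (hL _).contDiffAt hLk
  have h1 : ContMDiffAt 𝓘(ℂ, Fin n → ℂ) 𝓘(ℂ, Fin n → ℂ) ω (affineChart i) p :=
    (contMDiffOn_of_mem_maximalAtlas
      (IsManifold.subset_maximalAtlas (affineChart_mem_atlas i))).contMDiffAt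
      ((isOpen_affineOpen i).mem_nhds hi)
  have h2 : ContMDiffAt 𝓘(ℂ, Fin n → ℂ) 𝓘(ℂ, Fin n → ℂ) ω (affineChart k).symm
      (F (affineCoord i p)) :=
    (contMDiffOn_symm_of_mem_maximalAtlas
      (IsManifold.subset_maximalAtlas (affineChart_mem_atlas k))).contMDiffAt
      (isOpen_univ.mem_nhds (Set.mem_univ _))
  have h3 : ContMDiffAt 𝓘(ℂ, Fin n → ℂ) 𝓘(ℂ, Fin n → ℂ) ω
      (fun q => (affineChart k).symm (F (affineChart i q))) p :=
    ContMDiffAt.comp p (g := (affineChart k).symm) h2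
      (ContMDiffAt.comp p (g := F) hF.contMDiffAt h1)
  refine h3.congr_of_eventuallyEq ?_
  have hc : ContinuousAt (fun q => L (affineCoord i q) k) p :=
    (hL k).continuous.continuousAt.comp
      ((continuousOn_affineCoord i).continuousAt ((isOpen_affineOpen i).mem_nhds hi))
  filter_upwards [(isOpen_affineOpen i).mem_nhds hi, hc.eventually_ne hLk] with q hq hqk
  obtain ⟨h, e⟩ := hgp (affineCoord i q)
  rw [affinePoint_affineCoord i hq] at e
  have hq' : g • q ∈ affineOpen k := by
    rw [e]; exact hqk
  change g • q = affinePoint k (F (affineCoord i q))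
  rw [← affinePoint_affineCoord k hq', e]
  rfl

theorem contMDiff_smul (g : PSL(n + 1, ℂ)) :
    ContMDiff 𝓘(ℂ, Fin n → ℂ) 𝓘(ℂ, Fin n → ℂ) ω (fun p : ProjSpace n => g • p) := by
  induction g using QuotientGroup.induction_on with | H g =>
  exact contMDiff_smul_SL g

/-- The automorphism `L_g` of projective space defined by `g ∈ PSL(n+1, ℂ)`. -/
def L (g : PSL(n + 1, ℂ)) :
    ProjSpace n ≃ₘ^ω⟮𝓘(ℂ, Fin n → ℂ), 𝓘(ℂ, Fin n → ℂ)⟯ ProjSpace n where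
  toEquiv := MulAction.toPerm g
  contMDiff_toFun := contMDiff_smul g
  contMDiff_invFun := contMDiff_smul g⁻¹

theorem L_apply (g : PSL(n + 1, ℂ)) (p : ProjSpace n) : L g p = g • p := rfl

end ProjSpace

/-! ### The second prolongation of projective space -/

/-- The second prolongation `(ℙⁿ)^{(2)}`: the total space of `J¹(Tℙⁿ)`. -/
abbrev SecondProlongation (n : ℕ) : Type := OneJetTangent (Fin n → ℂ) (ProjSpace n)

namespace SecondProlongation

variable {n : ℕ}

/-- The action of `PSL(n+1, ℂ)` on the second prolongation through the prolonged maps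
`L_g^{(2)}`. -/
instance : MulAction PSL(n + 1, ℂ) (SecondProlongation n) where
  smul g q := OneJetTangent.prolong (ProjSpace.L g) q
  one_smul q := OneJetTangent.prolong_eq_self _ (fun x => one_smul PSL(n + 1, ℂ) x) q
  mul_smul g h q := OneJetTangent.prolong_comp _ _ _ (fun x => mul_smul g h x) q

theorem smul_def (g : PSL(n + 1, ℂ)) (q : SecondProlongation n) :
    g • q = OneJetTangent.prolong (ProjSpace.L g) q := rfl

/-- Names of the natural coordinates on the part of the second prolongation that lies over an
affine chart: `y_j` (affine coordinates of the base point), `z_j` and `w_{j₁ j₂}`. -/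
inductive CoordIndex (n : ℕ) : Type
  | y (j : Fin n)
  | z (j : Fin n)
  | w (j₁ j₂ : Fin n)

/-- The component functions `f_1, …, f_n` of a germ of vector field, in the affine chart `i`. -/
abbrev components (i : Fin (n + 1)) (s : HolVectorFieldGerm (Fin n → ℂ) (ProjSpace n)) :
    (Fin n → ℂ) → Fin n → ℂ :=
  coordComponents (ProjSpace.affineChart i) s.field

open scoped Classical in
/-- The natural coordinates over the affine chart `i`: the `1`-jet at `p` of `∑ f_k ∂/∂y_k` has
coordinates `y_j = y_j(p)`, `z_j = f_j(p)` and `w_{j₁ j₂} = ∂f_{j₂}/∂y_{j₁}(p)`. They are only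
meaningful for jets based at a point of the affine open subset `i` (and set to `0` elsewhere). -/
def coord (i : Fin (n + 1)) (q : SecondProlongation n) (c : CoordIndex n) : ℂ :=
  Quotient.lift (s := oneJetSetoid (Fin n → ℂ) (ProjSpace n))
    (fun s => if s.base ∈ ProjSpace.affineOpen i then
      (match c with
        | .y j => ProjSpace.affineCoord i s.base j
        | .z j => components i s (ProjSpace.affineCoord i s.base) j
        | .w j₁ j₂ => fderiv ℂ (components i s) (ProjSpace.affineCoord i s.base)
            (Pi.single j₁ 1) j₂)
      else 0)
    (by
      intro s t h
      have hb : s.base = t.base := h.1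
      by_cases hs : s.base ∈ ProjSpace.affineOpen i
      · obtain ⟨h0, h1⟩ := h.2 _ (ProjSpace.affineChart_mem_atlas i) hs
        have ht : t.base ∈ ProjSpace.affineOpen i := hb ▸ hs
        have h0' : components i s (ProjSpace.affineCoord i s.base) =
            components i t (ProjSpace.affineCoord i s.base) := h0
        have h1' : fderiv ℂ (components i s) (ProjSpace.affineCoord i s.base) =
            fderiv ℂ (components i t) (ProjSpace.affineCoord i s.base) := h1
        simp only [hs, ht, if_true]
        cases c
        · simp only [hb]
        · simp only [h0', ← hb]
        · simp only [h1', ← hb]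
      · have ht : t.base ∉ ProjSpace.affineOpen i := hb ▸ hs
        simp only [hs, ht, if_false]) q

/-- A subset of the second prolongation is Zariski closed if over each of the standard affine charts
it is the zero set, in the natural coordinates `(y, z, w)`, of a family of polynomials. -/
def IsZariskiClosed (Z : Set (SecondProlongation n)) : Prop :=
  ∀ i : Fin (n + 1), ∃ I : Set (MvPolynomial (CoordIndex n) ℂ),
    ∀ q : SecondProlongation n, q.proj ∈ ProjSpace.affineOpen i →
      (q ∈ Z ↔ ∀ f ∈ I, MvPolynomial.eval (coord i q) f = 0)

variable (n) in
/-- The Zariski topology of the second prolongation. -/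
abbrev zariskiTopology : TopologicalSpace (SecondProlongation n) :=
  TopologicalSpace.ofClosed {Z | IsZariskiClosed Z}
    (fun _ => ⟨{1}, fun q _ => by simp⟩)
    (fun A hA i => by
      choose! I hI using fun Z (hZ : Z ∈ A) => hA hZ i
      refine ⟨⋃ Z ∈ A, I Z, fun q hq => ?_⟩
      simp only [Set.mem_sInter, Set.mem_iUnion]
      constructor
      · rintro h f ⟨Z, hZ, hf⟩
        exact (hI Z hZ q hq).1 (h Z hZ) f hf
      · intro h Z hZ
        exact (hI Z hZ q hq).2 fun f hf => h f ⟨Z, hZ, hf⟩)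
    (fun Z hZ W hW i => by
      obtain ⟨I, hI⟩ := hZ i
      obtain ⟨J, hJ⟩ := hW i
      refine ⟨{h | ∃ f ∈ I, ∃ g ∈ J, h = f * g}, fun q hq => ?_⟩
      rw [Set.mem_union, hI q hq, hJ q hq]
      constructor
      · rintro (h | h) _ ⟨f, hf, g, hg, rfl⟩
        · rw [map_mul, h f hf, zero_mul]
        · rw [map_mul, h g hg, mul_zero]
      · intro h
        by_contra! hne
        obtain ⟨⟨f, hf, hf0⟩, ⟨g, hg, hg0⟩⟩ := hne
        have := h _ ⟨f, hf, g, hg, rfl⟩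
        rw [map_mul] at this
        exact (mul_ne_zero hf0 hg0) this)

end SecondProlongation

end

/-! In an affine chart a jet is a base point, a value `a` and a derivative matrix `B`. A projective
transformation is a quotient of affine maps, so its derivative `T` at a point determines its second
derivative up to one covector `β`: `F''(v, w) = -β(v) T w - β(w) T v`. Hence the jet transforms by
`a' = T a` and `B' T v = T B v - β(v) T a - β(a) T v`. Up to the scalar `β(a)`, this is state
feedback on the control pair `(B, a)`.

Controllability, that is, `a` being cyclic for `B`, is invariant under feedback
(`isCyclicVector_iff_of_feedback`). It therefore does not depend on the chart, and it is the
nonvanishing of a Krylov determinant, a nonzero polynomial in the coordinates. This gives the dense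
open set.

The crux is `IsCyclicVector.feedback_rigid`: only the trivial feedback fixes a controllable pair.
Taking traces gives `(n + 1) β(a) = 0`. Then `B - a ⊗ β` is conjugate to `B`, and comparing traces
of powers gives `β(B ^ m a) = 0` for all `m`, so `β = 0`. Now `T` commutes with `B` and fixes the
cyclic vector `a`, so `T = 1`. A transformation that fixes the base point with `T = 1` and `β = 0`
has a scalar matrix, hence is trivial in PSL. -/

/-! ### Linear algebra: cyclic vectors, feedback and the Krylov determinant -/

section CyclicVector

variable {K V : Type*} [Field K] [AddCommGroup V] [Module K V]

/-- The vector `a` is cyclic for the endomorphism `B`: no proper `B`-stable subspace contains `a`. -/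
def IsCyclicVector (B : V →ₗ[K] V) (a : V) : Prop :=
  ∀ W : Submodule K V, a ∈ W → (∀ w ∈ W, B w ∈ W) → W = ⊤

/-- The correction terms are multiples of `T a` and `T v`, so they stay in any subspace that
contains both. Thus `T` matches the `B`-stable subspaces through `a` with the `B'`-stable subspaces
through `T a`. -/
theorem isCyclicVector_iff_of_feedback {B B' : V →ₗ[K] V} {a a' : V} (T : V ≃ₗ[K] V)
    (β : V → K) (c : K) (ha : a' = T a)
    (h : ∀ v, B' (T v) = T (B v) - β v • T a - c • T v) :
    IsCyclicVector B' a' ↔ IsCyclicVector B a := by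
  subst ha
  constructor
  · intro H W ha hW
    have := H (W.map T.toLinearMap) ⟨a, ha, rfl⟩ (by
      rintro _ ⟨w, hw, rfl⟩
      refine ⟨B w - β w • a - c • w, ?_, ?_⟩
      · exact W.sub_mem (W.sub_mem (hW w hw) (W.smul_mem _ ha)) (W.smul_mem _ hw)
      · simp [h])
    rw [eq_top_iff]
    intro v _
    have hv : T v ∈ W.map T.toLinearMap := this ▸ Submodule.mem_top
    obtain ⟨w, hw, hwv⟩ := hv
    have : w = v := T.injective hwv
    exact this ▸ hw
  · intro H W ha hW
    have := H (W.comap T.toLinearMap) ha (by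
      intro w hw
      have e : T (B w) = B' (T w) + β w • T a + c • T w := by rw [h]; abel
      change T (B w) ∈ W
      rw [e]
      exact W.add_mem (W.add_mem (hW _ hw) (W.smul_mem _ ha)) (W.smul_mem _ hw))
    rw [eq_top_iff]
    intro v _
    have hv : T.symm v ∈ W.comap T.toLinearMap := this ▸ Submodule.mem_top
    simpa using hv

/-- The fixed space of `T` is `B`-stable and contains `a`. -/
theorem IsCyclicVector.ext_of_commute {B T : V →ₗ[K] V} {a : V} (h : IsCyclicVector B a)
    (hT : ∀ v, B (T v) = T (B v)) (ha : T a = a) (v : V) : T v = v := by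
  have := h (LinearMap.eqLocus T LinearMap.id) ha (fun w hw => by
    simp only [LinearMap.mem_eqLocus, LinearMap.id_apply] at hw ⊢
    rw [← hT, hw])
  exact (this ▸ Submodule.mem_top : v ∈ LinearMap.eqLocus T LinearMap.id)

/-- The common kernel of the functionals `β ∘ B ^ m` is `B`-stable and contains `a`; the case `m =
0` then gives `β = 0`. -/
theorem IsCyclicVector.functional_eq_zero {B : V →ₗ[K] V} {a : V} (h : IsCyclicVector B a)
    {β : V →ₗ[K] K} (hβ : ∀ m : ℕ, β ((B ^ m) a) = 0) : β = 0 := by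
  have := h (⨅ m : ℕ, LinearMap.ker (β ∘ₗ B ^ m)) (by simpa using hβ) (fun w hw => by
    simp only [Submodule.mem_iInf, LinearMap.mem_ker, LinearMap.comp_apply] at hw ⊢
    intro m
    have := hw (m + 1)
    rwa [pow_succ, Module.End.mul_apply] at this)
  ext v
  have hv : v ∈ ⨅ m : ℕ, LinearMap.ker (β ∘ₗ B ^ m) := this ▸ Submodule.mem_top
  simpa using (Submodule.mem_iInf _).1 hv 0

/-- A rank one perturbation `B - a ⊗ β` all of whose powers have the same traces as those of `B`
satisfies `β (B ^ m a) = 0` for all `m`. -/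
theorem functional_pow_eq_zero_of_trace [FiniteDimensional K V] [CharZero K] {B C : V →ₗ[K] V}
    {a : V} {β : V →ₗ[K] K} (hC : C = B - β.smulRight a)
    (ht : ∀ m : ℕ, LinearMap.trace K V (C ^ m) = LinearMap.trace K V (B ^ m)) (m : ℕ) :
    β ((B ^ m) a) = 0 := by
  induction m using Nat.strong_induction_on with
  | _ m ih =>
  have hpow : ∀ i ≤ m, (C ^ i) a = (B ^ i) a := by
    intro i
    induction i with
    | zero => simp
    | succ i hi =>
      intro him
      rw [pow_succ', pow_succ', Module.End.mul_apply, Module.End.mul_apply, hi (by omega), hC]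
      simp [ih i (by omega)]
  -- Telescoping: `C ^ (m+1) - B ^ (m+1) = ∑ C ^ i (C - B) B ^ (m-i)`. Each summand has rank at most
  -- one and trace `-β (B ^ m a)`, so equality of traces gives `(m + 1) β (B ^ m a) = 0`.
  have hsum := Finset.sum_range_sub (fun i => C ^ i * B ^ (m + 1 - i)) (m + 1)
  have hterm : ∀ i ∈ Finset.range (m + 1),
      LinearMap.trace K V (C ^ (i + 1) * B ^ (m + 1 - (i + 1)) - C ^ i * B ^ (m + 1 - i)) =
        -β ((B ^ m) a) := by
    intro i hi
    have him : i ≤ m := Nat.lt_succ_iff.1 (Finset.mem_range.1 hi)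
    have e1 : m + 1 - (i + 1) = m - i := by omega
    have e2 : m + 1 - i = m - i + 1 := by omega
    have e3 : C ^ (i + 1) * B ^ (m + 1 - (i + 1)) - C ^ i * B ^ (m + 1 - i) =
        -((β ∘ₗ B ^ (m - i)).smulRight ((C ^ i) a)) := by
      rw [e1, e2, pow_succ, pow_succ' B, mul_assoc, ← mul_sub, ← sub_mul]
      have : C - B = -β.smulRight a := by rw [hC]; abel
      rw [this]
      ext v
      simp
    rw [e3, map_neg, LinearMap.trace_smulRight, hpow i him, LinearMap.comp_apply, ← Module.End.mul_apply,
      ← pow_add, Nat.sub_add_cancel him]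
  have := congrArg (LinearMap.trace K V) hsum
  rw [map_sum, Finset.sum_congr rfl hterm, map_sub] at this
  simp only [Finset.sum_const, Finset.card_range, Nat.sub_self, pow_zero, mul_one, one_mul,
    Nat.sub_zero, ht, sub_self, smul_neg, neg_eq_zero, nsmul_eq_mul, mul_eq_zero] at this
  exact this.resolve_left (Nat.cast_ne_zero.2 (Nat.succ_ne_zero m))

/-- Conjugation by `T` preserves the traces of all powers of `B`. The first trace kills the scalar
term `β a`, the higher ones kill `β` on the orbit of `a`, and cyclicity does the rest. -/
theorem IsCyclicVector.feedback_rigid [FiniteDimensional K V] [CharZero K] {B : V →ₗ[K] V}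
    {a : V} (h : IsCyclicVector B a) (T : V ≃ₗ[K] V) (β : V →ₗ[K] K) (ha : T a = a)
    (hT : ∀ v, B (T v) = T (B v) - β v • T a - β a • T v) :
    (∀ v, T v = v) ∧ β = 0 := by
  have hC : T.symm.conj B = B - β.smulRight a - β a • LinearMap.id := by
    ext v
    simp [LinearEquiv.conj_apply, hT]
  have htr := congrArg (LinearMap.trace K V) hC
  rw [LinearMap.trace_conj', map_sub, map_sub, LinearMap.trace_smulRight, map_smul, LinearMap.trace_id,
    sub_sub, eq_comm, sub_eq_self, smul_eq_mul] at htr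
  have hβa : β a = 0 := by
    -- The rank one term contributes `β a` to the trace and the scalar term contributes `β a * dim
    -- V`.
    have : β a * ((Module.finrank K V : K) + 1) = 0 := by rw [← htr]; ring
    exact (mul_eq_zero.1 this).resolve_right (Nat.cast_add_one_ne_zero _)
  rw [hβa, zero_smul, sub_zero] at hC
  have hβ : β = 0 := h.functional_eq_zero (functional_pow_eq_zero_of_trace hC fun m => by
    have : (T.symm.conj B) ^ m = T.symm.conj (B ^ m) := by
      induction m with
      | zero => simp [Module.End.one_eq_id]
      | succ m ih =>
        rw [pow_succ, pow_succ, ih, Module.End.mul_eq_comp, Module.End.mul_eq_comp,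
          LinearEquiv.conj_comp]
    rw [this, LinearMap.trace_conj'])
  refine ⟨fun v => h.ext_of_commute (T := T.toLinearMap) (fun v => ?_) ha v, hβ⟩
  simp [hT, hβ]

/-- The matrix with columns `a, B a, …, B ^ (n - 1) a`. -/
def krylovMatrix {R : Type*} [CommRing R] {n : ℕ} (B : Matrix (Fin n) (Fin n) R) (a : Fin n → R) :
    Matrix (Fin n) (Fin n) R :=
  Matrix.of fun j k => ((B ^ (k : ℕ)).mulVec a) j

theorem toLin'_pow_apply {n : ℕ} (B : Matrix (Fin n) (Fin n) K) (a : Fin n → K) (m : ℕ) :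
    (Matrix.toLin' B ^ m) a = (B ^ m).mulVec a := by
  rw [← Matrix.toLin'_pow, Matrix.toLin'_apply]

/-- A left null vector of the Krylov matrix is a functional that kills `B ^ m a` for `m < n`, hence
for all `m` by Cayley–Hamilton. Conversely, the columns of an invertible Krylov matrix span, and
they lie in every `B`-stable subspace through `a`. -/
theorem isCyclicVector_iff_det_krylovMatrix_ne_zero {n : ℕ} (B : Matrix (Fin n) (Fin n) K)
    (a : Fin n → K) :
    IsCyclicVector (Matrix.toLin' B) a ↔ (krylovMatrix B a).det ≠ 0 := by
  constructor
  · intro h h0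
    obtain ⟨b, hb, hb0⟩ := Matrix.exists_vecMul_eq_zero_iff.2 h0
    apply hb
    let β : (Fin n → K) →ₗ[K] K := LinearMap.mk₂ K (fun v w => w ⬝ᵥ v)
      (by simp) (by simp) (by simp) (by simp) |>.flip b
    have hβ : ∀ v, β v = b ⬝ᵥ v := fun v => rfl
    have hk : ∀ m : ℕ, m < n → β ((Matrix.toLin' B ^ m) a) = 0 := by
      intro m hm
      rw [hβ, toLin'_pow_apply]
      exact congrFun hb0 ⟨m, hm⟩
    have : β = 0 := h.functional_eq_zero fun m => by
      rw [LinearMap.pow_eq_aeval_mod_charpoly]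
      by_cases hn : n = 0
      -- For `n = 0` the remainder modulo the characteristic polynomial cannot have `natDegree < n`;
      -- here the space is zero.
      · subst hn; rw [hβ]; simp
      have hd : ((Polynomial.X ^ m : Polynomial K) %ₘ (Matrix.toLin' B).charpoly).natDegree < n := by
        have := Polynomial.natDegree_modByMonic_lt (Polynomial.X ^ m : Polynomial K)
          (LinearMap.charpoly_monic (Matrix.toLin' B)) (by
            intro h1
            have := congrArg Polynomial.natDegree h1
            rw [LinearMap.charpoly_natDegree] at this
            simp at this
            exact hn this)
        rwa [LinearMap.charpoly_natDegree, Module.finrank_fin_fun] at this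
      rw [Polynomial.aeval_eq_sum_range' hd, LinearMap.sum_apply, map_sum]
      refine Finset.sum_eq_zero fun i hi => ?_
      rw [LinearMap.smul_apply, map_smul, hk i (Finset.mem_range.1 hi), smul_zero]
    funext j
    have := LinearMap.congr_fun this (Pi.single j 1)
    rw [hβ] at this
    simpa using this
  · intro h W ha hW
    have hpow : ∀ m : ℕ, (B ^ m).mulVec a ∈ W := by
      intro m
      induction m with
      | zero => simpa using ha
      | succ m ih =>
        rw [pow_succ', ← Matrix.mulVec_mulVec]
        exact hW _ ih
    rw [eq_top_iff]
    intro v _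
    have hu : IsUnit (krylovMatrix B a).det := isUnit_iff_ne_zero.2 h
    have hv : (krylovMatrix B a).mulVec ((krylovMatrix B a)⁻¹.mulVec v) = v := by
      rw [Matrix.mulVec_mulVec, Matrix.mul_nonsing_inv _ hu, Matrix.one_mulVec]
    rw [← hv, Matrix.mulVec_eq_sum]
    refine W.sum_mem fun k _ => ?_
    rw [op_smul_eq_smul]
    exact W.smul_mem _ (hpow k)

theorem exists_det_krylovMatrix_ne_zero (n : ℕ) :
    ∃ (B : Matrix (Fin n) (Fin n) K) (a : Fin n → K), (krylovMatrix B a).det ≠ 0 := by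
  -- The nilpotent shift and the first basis vector: the Krylov matrix is the identity.
  let B : Matrix (Fin n) (Fin n) K := Matrix.of fun i j => if (i : ℕ) = j + 1 then 1 else 0
  let a : Fin n → K := fun i => if (i : ℕ) = 0 then 1 else 0
  refine ⟨B, a, ?_⟩
  have hpow : ∀ m : ℕ, m < n → (B ^ m).mulVec a = fun i : Fin n => if (i : ℕ) = m then 1 else 0 := by
    intro m
    induction m with
    | zero => intro _; simp [a]
    | succ m ih =>
      intro hm
      rw [pow_succ', ← Matrix.mulVec_mulVec, ih (by omega)]
      funext i
      simp only [Matrix.mulVec, dotProduct, B, Matrix.of_apply]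
      rw [Finset.sum_eq_single ⟨m, by omega⟩]
      · simp
      · intro j _ hj
        have : (j : ℕ) ≠ m := fun e => hj (Fin.ext e)
        simp [this]
      · simp
  have : krylovMatrix B a = 1 := by
    ext j k
    simp only [krylovMatrix, Matrix.of_apply, hpow k k.2, Matrix.one_apply, Fin.ext_iff]
  simp [this]

end CyclicVector

noncomputable section

/-! ### Derivatives of quotients of affine maps -/

section QuotientOfAffine

variable {E E' : Type*} [NormedAddCommGroup E] [NormedSpace ℂ E] [NormedAddCommGroup E']
  [NormedSpace ℂ E']

/-- First derivative of a quotient `N / l` of affine maps, without denominators. -/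
theorem fderiv_affine_quotient {l : E → ℂ} {N : E → E'} {l' : E →L[ℂ] ℂ} {N' : E →L[ℂ] E'}
    (hl : ∀ u, HasFDerivAt l l' u) (hN : ∀ u, HasFDerivAt N N' u) {x : E} (hx : l x ≠ 0) :
    ∃ T : E →L[ℂ] E', HasFDerivAt (fun u => (l u)⁻¹ • N u) T x ∧
      ∀ v, l x • T v + l' v • (l x)⁻¹ • N x = N' v := by
  have h1 : DifferentiableAt ℂ (fun u => (l u)⁻¹ • N u) x :=
    ((hl x).differentiableAt.inv hx).smul (hN x).differentiableAt
  refine ⟨_, h1.hasFDerivAt, fun v => ?_⟩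
  -- Differentiate the identity `l • (N / l) = N` with the product rule.
  have h2 := (hl x).smul h1.hasFDerivAt
  have h3 : N =ᶠ[nhds x] fun u => l u • (l u)⁻¹ • N u := by
    filter_upwards [(hl x).continuousAt.eventually_ne hx] with u hu
    rw [smul_inv_smul₀ hu]
  have h4 := (h2.congr_of_eventuallyEq h3).unique (hN x)
  rw [← h4]
  simp

/-- Second derivative of a quotient `N / l` of affine maps, without denominators. -/
theorem fderiv_fderiv_affine_quotient {l : E → ℂ} {N : E → E'} {l' : E →L[ℂ] ℂ}
    {N' : E →L[ℂ] E'} (hl : ∀ u, HasFDerivAt l l' u) (hN : ∀ u, HasFDerivAt N N' u) {x : E}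
    (hx : l x ≠ 0) (hF : DifferentiableAt ℂ (fderiv ℂ (fun u => (l u)⁻¹ • N u)) x) (v w : E) :
    l x • fderiv ℂ (fderiv ℂ (fun u => (l u)⁻¹ • N u)) x w v +
      l' w • fderiv ℂ (fun u => (l u)⁻¹ • N u) x v +
      l' v • fderiv ℂ (fun u => (l u)⁻¹ • N u) x w = 0 := by
  set F : E → E' := fun u => (l u)⁻¹ • N u with hFdef
  have h1 : DifferentiableAt ℂ F x :=
    ((hl x).differentiableAt.inv hx).smul (hN x).differentiableAt
  -- The first-order identity holds near `x` and its right side is constant, so it can be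
  -- differentiated once more.
  have h2 : (fun u => l u • fderiv ℂ F u v + l' v • F u) =ᶠ[nhds x] fun _ => N' v := by
    filter_upwards [(hl x).continuousAt.eventually_ne hx] with u hu
    obtain ⟨T, hT, h⟩ := fderiv_affine_quotient hl hN hu
    rw [hT.fderiv]
    exact h v
  have h3 := (((hl x).smul (hF.hasFDerivAt.clm_apply (hasFDerivAt_const v x))).add
    (h1.hasFDerivAt.const_smul (l' v)))
  have h4 := (h3.congr_of_eventuallyEq h2.symm).unique (hasFDerivAt_const (N' v) x)
  have := congrArg (fun f : E →L[ℂ] E' => f w) h4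
  simpa using this

end QuotientOfAffine

/-! ### Projective transformations in affine coordinates -/

namespace ProjSpace

variable {n : ℕ}

/-- Homogeneous coordinates of the image under `g` of the point with affine coordinates `u`. -/
def homogImage (g : SL(n + 1, ℂ)) (i : Fin (n + 1)) (u : Fin n → ℂ) : Fin (n + 1) → ℂ :=
  (g : Matrix (Fin (n + 1)) (Fin (n + 1)) ℂ).mulVec (i.insertNth (1 : ℂ) u)

/-- The linear part of `homogImage g i`. -/
def homogImageLinear (g : SL(n + 1, ℂ)) (i : Fin (n + 1)) : (Fin n → ℂ) →L[ℂ] (Fin (n + 1) → ℂ) :=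
  LinearMap.toContinuousLinearMap
    ((Matrix.toLin' (g : Matrix (Fin (n + 1)) (Fin (n + 1)) ℂ)) ∘ₗ
      { toFun := fun v => i.insertNth (0 : ℂ) v
        map_add' := fun v w => by
          funext k
          refine Fin.succAboveCases i ?_ (fun j => ?_) k <;> simp
        map_smul' := fun c v => by
          funext k
          refine Fin.succAboveCases i ?_ (fun j => ?_) k <;> simp })

theorem homogImageLinear_apply (g : SL(n + 1, ℂ)) (i : Fin (n + 1)) (v : Fin n → ℂ) :
    homogImageLinear g i v =
      (g : Matrix (Fin (n + 1)) (Fin (n + 1)) ℂ).mulVec (i.insertNth (0 : ℂ) v) := rfl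

theorem homogImage_eq (g : SL(n + 1, ℂ)) (i : Fin (n + 1)) (u : Fin n → ℂ) :
    homogImage g i u = homogImageLinear g i u + homogImage g i 0 := by
  rw [homogImageLinear_apply, homogImage, homogImage, ← Matrix.mulVec_add]
  congr 1
  funext k
  refine Fin.succAboveCases i ?_ (fun j => ?_) k <;> simp

theorem hasFDerivAt_homogImage (g : SL(n + 1, ℂ)) (i : Fin (n + 1)) (u : Fin n → ℂ) :
    HasFDerivAt (homogImage g i) (homogImageLinear g i) u := by
  have : homogImage g i = fun u => homogImageLinear g i u + homogImage g i 0 :=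
    funext (homogImage_eq g i)
  rw [this]
  exact (homogImageLinear g i).hasFDerivAt.add_const _

/-- Forgetting the `k`-th homogeneous coordinate. -/
def dropCoord (k : Fin (n + 1)) : (Fin (n + 1) → ℂ) →L[ℂ] (Fin n → ℂ) :=
  ContinuousLinearMap.pi fun j => ContinuousLinearMap.proj (k.succAbove j)

theorem affineChart_L_eq (g : SL(n + 1, ℂ)) (i k : Fin (n + 1)) :
    (affineChart k ∘ L (g : PSL(n + 1, ℂ)) ∘ (affineChart i).symm :
      (Fin n → ℂ) → (Fin n → ℂ)) =
      fun u => (homogImage g i u k)⁻¹ • dropCoord k (homogImage g i u) := by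
  funext u j
  exact div_eq_inv_mul _ _

theorem L_affinePoint_mem (g : SL(n + 1, ℂ)) (i k : Fin (n + 1)) (u : Fin n → ℂ) :
    L (g : PSL(n + 1, ℂ)) (affinePoint i u) ∈ affineOpen k ↔ homogImage g i u k ≠ 0 := Iff.rfl

theorem L_symm (g : SL(n + 1, ℂ)) (p : ProjSpace n) :
    (L (g : PSL(n + 1, ℂ))).symm p = L ((g⁻¹ : SL(n + 1, ℂ)) : PSL(n + 1, ℂ)) p := rfl

/-- The linear algebra behind the derivatives of the coordinate expression of a projective
transformation. -/
theorem exists_derivatives (g : SL(n + 1, ℂ)) {i k : Fin (n + 1)} {p : ProjSpace n}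
    (hi : p ∈ affineOpen i) (hk : L (g : PSL(n + 1, ℂ)) p ∈ affineOpen k) :
    ∃ (T : (Fin n → ℂ) ≃ₗ[ℂ] (Fin n → ℂ)) (β : (Fin n → ℂ) →ₗ[ℂ] ℂ) (c : ℂ), c ≠ 0 ∧
      (∀ v, fderiv ℂ (affineChart k ∘ L (g : PSL(n + 1, ℂ)) ∘ (affineChart i).symm)
        (affineCoord i p) v = T v) ∧
      (∀ v, fderiv ℂ (affineChart i ∘ (L (g : PSL(n + 1, ℂ))).symm ∘ (affineChart k).symm)
        (affineCoord k (L (g : PSL(n + 1, ℂ)) p)) (T v) = v) ∧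
      (∀ v w, fderiv ℂ (fderiv ℂ (affineChart k ∘ L (g : PSL(n + 1, ℂ)) ∘ (affineChart i).symm))
        (affineCoord i p) v w = - (β v • T w) - β w • T v) ∧
      homogImage g i (affineCoord i p) =
        c • k.insertNth (1 : ℂ) (affineCoord k (L (g : PSL(n + 1, ℂ)) p)) ∧
      ∀ v, homogImageLinear g i v =
        c • k.insertNth (β v) (T v + β v • affineCoord k (L (g : PSL(n + 1, ℂ)) p)) := by
  set x := affineCoord i p with hx
  set y := affineCoord k (L (g : PSL(n + 1, ℂ)) p) with hy
  have hpx : affinePoint i x = p := affinePoint_affineCoord i hi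
  have hpy : affinePoint k y = L (g : PSL(n + 1, ℂ)) p := affinePoint_affineCoord k hk
  have hl : ∀ (g : SL(n + 1, ℂ)) (i k : Fin (n + 1)) u, HasFDerivAt (fun u => homogImage g i u k)
      ((ContinuousLinearMap.proj k : (Fin (n + 1) → ℂ) →L[ℂ] ℂ) ∘L homogImageLinear g i) u :=
    fun g i k u => (ContinuousLinearMap.proj k : (Fin (n + 1) → ℂ) →L[ℂ] ℂ).hasFDerivAt.comp u
      (hasFDerivAt_homogImage g i u)
  have hN : ∀ (g : SL(n + 1, ℂ)) (i k : Fin (n + 1)) u,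
      HasFDerivAt (fun u => dropCoord k (homogImage g i u))
      (dropCoord k ∘L homogImageLinear g i) u :=
    fun g i k u => (dropCoord k).hasFDerivAt.comp u (hasFDerivAt_homogImage g i u)
  have hc : homogImage g i x k ≠ 0 := by
    rw [← L_affinePoint_mem, hpx]; exact hk
  have hc' : homogImage g⁻¹ k y i ≠ 0 := by
    rw [← L_affinePoint_mem, hpy, ← L_symm, Diffeomorph.symm_apply_apply]; exact hi
  obtain ⟨T, hT, hT'⟩ := fderiv_affine_quotient (hl g i k) (hN g i k) hc
  obtain ⟨S, hS, -⟩ := fderiv_affine_quotient (hl g⁻¹ k i) (hN g⁻¹ k i) hc'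
  rw [← affineChart_L_eq] at hT hS
  have hFx : (affineChart k ∘ L (g : PSL(n + 1, ℂ)) ∘ (affineChart i).symm) x = y := by
    change affineCoord k (L (g : PSL(n + 1, ℂ)) (affinePoint i x)) = y
    rw [hpx]
  -- The coordinate expressions of `g` and `g⁻¹` are inverse to each other near `x`; this makes `T`
  -- injective, hence invertible.
  have hST : S ∘L T = ContinuousLinearMap.id ℂ _ := by
    rw [← hFx] at hS
    refine ((hS.comp x hT).congr_of_eventuallyEq ?_).unique (hasFDerivAt_id x)
    filter_upwards [(hl g i k x).continuousAt.eventually_ne hc] with u hu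
    have hu' : L (g : PSL(n + 1, ℂ)) (affinePoint i u) ∈ affineOpen k := hu
    change u = affineCoord i ((L (g : PSL(n + 1, ℂ))).symm
      (affinePoint k (affineCoord k (L (g : PSL(n + 1, ℂ)) (affinePoint i u)))))
    rw [affinePoint_affineCoord k hu', Diffeomorph.symm_apply_apply, affineCoord_affinePoint]
  have hSTv : ∀ v, S (T v) = v := fun v => congrArg (fun f : (Fin n → ℂ) →L[ℂ] _ => f v) hST
  have hinj : Function.Injective T.toLinearMap := fun v w h => by
    rw [← hSTv v, ← hSTv w]; exact congrArg S h
  have hyF : (homogImage g i x k)⁻¹ • dropCoord k (homogImage g i x) = y := by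
    rw [← hFx, affineChart_L_eq]
  -- With `l` the `k`-th homogeneous coordinate of the image, `β` is the logarithmic derivative `l'
  -- / l(x)` and `c = l(x)`.
  refine ⟨LinearEquiv.ofInjectiveEndo T.toLinearMap hinj,
    (homogImage g i x k)⁻¹ • ((LinearMap.proj k) ∘ₗ (homogImageLinear g i).toLinearMap),
    homogImage g i x k, hc, ?_, ?_, ?_, ?_, ?_⟩
  · intro v
    rw [hT.fderiv]; rfl
  · intro v
    change fderiv ℂ (affineChart i ∘ L ((g⁻¹ : SL(n + 1, ℂ)) : PSL(n + 1, ℂ)) ∘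
      (affineChart k).symm) y (T v) = v
    rw [hS.fderiv, hSTv]
  · intro v w
    have hd : DifferentiableAt ℂ
        (fderiv ℂ (fun u => (homogImage g i u k)⁻¹ • dropCoord k (homogImage g i u))) x := by
      have e : homogImage g i = fun u => homogImageLinear g i u + homogImage g i 0 :=
        funext (homogImage_eq g i)
      have hs : ContDiff ℂ ω (homogImage g i) := by
        rw [e]; exact (homogImageLinear g i).contDiff.add contDiff_const
      have hF : ContDiffAt ℂ ω
          (fun u => (homogImage g i u k)⁻¹ • dropCoord k (homogImage g i u)) x :=
        ((contDiff_pi.1 hs k).contDiffAt.inv hc).smul ((dropCoord k).contDiff.comp hs).contDiffAt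
      exact (hF.fderiv_right (m := 1) le_top).differentiableAt (by simp)
    have := fderiv_fderiv_affine_quotient (hl g i k) (hN g i k) hc hd w v
    rw [← affineChart_L_eq, hT.fderiv] at this
    have h2 := congrArg (fun z => (homogImage g i x k)⁻¹ • z) this
    simp only [smul_add, smul_zero, inv_smul_smul₀ hc] at h2
    rw [add_assoc] at h2
    rw [eq_neg_of_add_eq_zero_left h2]
    funext j
    simp [mul_assoc]
    ring
  · funext m
    refine Fin.succAboveCases k ?_ (fun j => ?_) m
    · simp
    · have := congrFun hyF j
      simp only [Pi.smul_apply, smul_eq_mul, Fin.insertNth_apply_succAbove, ← this]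
      rw [mul_inv_cancel_left₀ hc]; rfl
  · intro v
    have := hT' v
    rw [hyF] at this
    funext m
    refine Fin.succAboveCases k ?_ (fun j => ?_) m
    · simp [hc]
    · have := congrFun this j
      simp only [Pi.smul_apply, smul_eq_mul, Fin.insertNth_apply_succAbove, Pi.add_apply]
      simp only [Pi.smul_apply, smul_eq_mul, Pi.add_apply, ContinuousLinearMap.comp_apply] at this
      change _ = homogImageLinear g i v (k.succAbove j) at this
      rw [← this]
      simp only [mul_add, ContinuousLinearMap.proj_apply, LinearMap.smul_apply,
        LinearMap.comp_apply, LinearMap.proj_apply, smul_eq_mul, ContinuousLinearMap.coe_coe]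
      rw [← mul_assoc, mul_inv_cancel_left₀ hc]
      rfl

end ProjSpace

/-! ### The action on jets in affine coordinates -/

namespace SecondProlongation

variable {n : ℕ}

/-- The components of the value of a jet in the affine chart `i`. -/
def valueVec (i : Fin (n + 1)) (q : SecondProlongation n) : Fin n → ℂ :=
  fun j => coord i q (.z j)

/-- The matrix of first derivatives of a jet in the affine chart `i`. -/
def derivMatrix (i : Fin (n + 1)) (q : SecondProlongation n) : Matrix (Fin n) (Fin n) ℂ :=
  Matrix.of fun j₂ j₁ => coord i q (.w j₁ j₂)

theorem valueVec_mk (i : Fin (n + 1)) (s : HolVectorFieldGerm (Fin n → ℂ) (ProjSpace n))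
    (hs : s.base ∈ ProjSpace.affineOpen i) :
    valueVec i (OneJetTangent.mk s) = components i s (ProjSpace.affineCoord i s.base) := by
  funext j
  exact if_pos hs

theorem derivMatrix_mk (i : Fin (n + 1)) (s : HolVectorFieldGerm (Fin n → ℂ) (ProjSpace n))
    (hs : s.base ∈ ProjSpace.affineOpen i) (v : Fin n → ℂ) :
    Matrix.toLin' (derivMatrix i (OneJetTangent.mk s)) v =
      fderiv ℂ (components i s) (ProjSpace.affineCoord i s.base) v := by
  have h : Matrix.toLin' (derivMatrix i (OneJetTangent.mk s)) =
      (fderiv ℂ (components i s) (ProjSpace.affineCoord i s.base)).toLinearMap := by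
    refine LinearMap.pi_ext' fun j₁ => LinearMap.ext_ring (funext fun j₂ => ?_)
    simp only [LinearMap.comp_apply, LinearMap.single_apply, Matrix.toLin'_apply,
      Matrix.mulVec_single_one]
    exact if_pos hs
  exact congrArg (fun f : (Fin n → ℂ) →ₗ[ℂ] _ => f v) h

/-- The action of a projective transformation on jets in affine coordinates. -/
theorem exists_action_formula (g : SL(n + 1, ℂ)) (q : SecondProlongation n) :
    ∃ i, q.proj ∈ ProjSpace.affineOpen i ∧
      ∀ k, ((g : PSL(n + 1, ℂ)) • q).proj ∈ ProjSpace.affineOpen k →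
    ∃ (T : (Fin n → ℂ) ≃ₗ[ℂ] (Fin n → ℂ)) (β : (Fin n → ℂ) →ₗ[ℂ] ℂ) (c : ℂ), c ≠ 0 ∧
      valueVec k ((g : PSL(n + 1, ℂ)) • q) = T (valueVec i q) ∧
      (∀ v, Matrix.toLin' (derivMatrix k ((g : PSL(n + 1, ℂ)) • q)) (T v) =
        T (Matrix.toLin' (derivMatrix i q) v) - β v • T (valueVec i q) -
          β (valueVec i q) • T v) ∧
      ProjSpace.homogImage g i (ProjSpace.affineCoord i q.proj) =
        c • k.insertNth (1 : ℂ) (ProjSpace.affineCoord k ((g : PSL(n + 1, ℂ)) • q).proj) ∧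
      ∀ v, ProjSpace.homogImageLinear g i v = c • k.insertNth (β v)
        (T v + β v • ProjSpace.affineCoord k ((g : PSL(n + 1, ℂ)) • q).proj) := by
  induction q using Quotient.ind with | _ s =>
  -- The source chart is not free: the push-forward formula is stated in the preferred chart
  -- `chartAt` at the base point.
  obtain ⟨i, hi⟩ : ∃ i, ProjSpace.affineChart i = chartAt (Fin n → ℂ) s.base :=
    chart_mem_atlas (Fin n → ℂ) s.base
  have hs : s.base ∈ ProjSpace.affineOpen i := by
    have := mem_chart_source (Fin n → ℂ) s.base
    rw [← hi] at this
    exact this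
  refine ⟨i, hs, fun k hk => ?_⟩
  have hk' : ProjSpace.L (g : PSL(n + 1, ℂ)) s.base ∈ ProjSpace.affineOpen k := hk
  obtain ⟨T, β, c, hc, h1, h2, h3, h4, h5⟩ := ProjSpace.exists_derivatives g hs hk'
  obtain ⟨k0, k1⟩ := coordComponents_push_hasFDerivAt (ProjSpace.L (g : PSL(n + 1, ℂ))) s
    (ProjSpace.affineChart_mem_atlas k) hk'
  rw [← hi] at k0 k1
  refine ⟨T, β, c, hc, ?_, ?_, h4, h5⟩
  · change valueVec k (OneJetTangent.mk (s.push _)) = T (valueVec i (OneJetTangent.mk s))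
    rw [valueVec_mk i s hs, valueVec_mk k _ hk', ← h1]
    exact k0
  · intro v
    change Matrix.toLin' (derivMatrix k (OneJetTangent.mk (s.push _))) (T v) =
      T (Matrix.toLin' (derivMatrix i (OneJetTangent.mk s)) v) -
        β v • T (valueVec i (OneJetTangent.mk s)) - β (valueVec i (OneJetTangent.mk s)) • T v
    rw [valueVec_mk i s hs, derivMatrix_mk i s hs, derivMatrix_mk k _ hk']
    have k2 := congrArg (fun f : (Fin n → ℂ) →L[ℂ] (Fin n → ℂ) => f (T v)) k1.fderiv
    refine k2.trans ?_
    have h2v : fderiv ℂ (ProjSpace.affineChart i ∘ (ProjSpace.L (g : PSL(n + 1, ℂ))).symm ∘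
      (ProjSpace.affineChart k).symm) (ProjSpace.affineChart k
        (ProjSpace.L (g : PSL(n + 1, ℂ)) s.base)) (T v) = v := h2 v
    simp only [ContinuousLinearMap.comp_apply, add_apply,
      ContinuousLinearMap.flip_apply]
    rw [h2v]
    -- The new derivative at `T v` is `T (B v) + F''(v, a)`, and `h3` expands the second term.
    refine (congrArg₂ (· + ·) (h1 _) (h3 _ _)).trans ?_
    abel

end SecondProlongation

/-! ### Vector fields with prescribed components in a chart -/

namespace ProjSpace

variable {n : ℕ}

theorem contMDiff_affineChart_symm (i : Fin (n + 1)) :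
    ContMDiff 𝓘(ℂ, Fin n → ℂ) 𝓘(ℂ, Fin n → ℂ) ω (affineChart i).symm := fun _ =>
  (contMDiffOn_symm_of_mem_maximalAtlas
    (IsManifold.subset_maximalAtlas (affineChart_mem_atlas i))).contMDiffAt
    (isOpen_univ.mem_nhds (Set.mem_univ _))

theorem contMDiffAt_affineChart (i : Fin (n + 1)) {p : ProjSpace n} (hp : p ∈ affineOpen i) :
    ContMDiffAt 𝓘(ℂ, Fin n → ℂ) 𝓘(ℂ, Fin n → ℂ) ω (affineChart i) p :=
  (contMDiffOn_of_mem_maximalAtlas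
    (IsManifold.subset_maximalAtlas (affineChart_mem_atlas i))).contMDiffAt
    ((isOpen_affineOpen i).mem_nhds hp)

/-- The vector field with holomorphic components `f` in the affine chart `i`. -/
def vectorField (i : Fin (n + 1)) (f : (Fin n → ℂ) → Fin n → ℂ) (p : ProjSpace n) :
    TangentBundle 𝓘(ℂ, Fin n → ℂ) (ProjSpace n) :=
  -- The base point is set to `p` by hand, so that this is a section even off `affineOpen i`, where
  -- the chart inverse need not return to `p`.
  ⟨p, (tangentMap 𝓘(ℂ, Fin n → ℂ) 𝓘(ℂ, Fin n → ℂ) (affineChart i).symm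
    (⟨affineCoord i p, f (affineCoord i p)⟩ : TangentBundle 𝓘(ℂ, Fin n → ℂ) (Fin n → ℂ))).snd⟩

theorem vectorField_eq (i : Fin (n + 1)) (f : (Fin n → ℂ) → Fin n → ℂ) {p : ProjSpace n}
    (hp : p ∈ affineOpen i) :
    vectorField i f p = tangentMap 𝓘(ℂ, Fin n → ℂ) 𝓘(ℂ, Fin n → ℂ) (affineChart i).symm
      (⟨affineCoord i p, f (affineCoord i p)⟩ : TangentBundle 𝓘(ℂ, Fin n → ℂ) (Fin n → ℂ)) := by
  have h : p = affinePoint i (affineCoord i p) := (affinePoint_affineCoord i hp).symm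
  rw [vectorField]
  exact Bundle.TotalSpace.ext h HEq.rfl

theorem contMDiffAt_vectorField (i : Fin (n + 1)) {f : (Fin n → ℂ) → Fin n → ℂ}
    (hf : ContDiff ℂ ω f) {p : ProjSpace n} (hp : p ∈ affineOpen i) :
    ContMDiffAt 𝓘(ℂ, Fin n → ℂ) 𝓘(ℂ, Fin n → ℂ).tangent ω (vectorField i f) p := by
  have h1 : ContMDiff 𝓘(ℂ, Fin n → ℂ).tangent 𝓘(ℂ, Fin n → ℂ).tangent ω
      (tangentMap 𝓘(ℂ, Fin n → ℂ) 𝓘(ℂ, Fin n → ℂ) (affineChart (n := n) i).symm) :=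
    (contMDiff_affineChart_symm i).contMDiff_tangentMap le_top
  have h2 : ContMDiff 𝓘(ℂ, Fin n → ℂ) 𝓘(ℂ, Fin n → ℂ).tangent ω
      (fun u => (⟨u, f u⟩ : TangentBundle 𝓘(ℂ, Fin n → ℂ) (Fin n → ℂ))) := by
    intro u
    rw [Bundle.contMDiffAt_totalSpace]
    refine ⟨contMDiffAt_id, ?_⟩
    simpa using hf.contMDiff.contMDiffAt
  have h3 := ContMDiffAt.comp p h1.contMDiffAt
    (ContMDiffAt.comp p (h2.contMDiffAt (x := affineChart i p)) (contMDiffAt_affineChart i hp))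
  refine h3.congr_of_eventuallyEq ?_
  filter_upwards [(isOpen_affineOpen i).mem_nhds hp] with q hq
  exact vectorField_eq i f hq

theorem coordComponents_vectorField (i : Fin (n + 1)) (f : (Fin n → ℂ) → Fin n → ℂ) :
    coordComponents (affineChart i) (vectorField i f) = f := by
  funext u
  have hm := affinePoint_mem i u
  have h1 : vectorField i f ((affineChart i).symm u) =
      tangentMap 𝓘(ℂ, Fin n → ℂ) 𝓘(ℂ, Fin n → ℂ) (affineChart i).symm
        (⟨u, f u⟩ : TangentBundle 𝓘(ℂ, Fin n → ℂ) (Fin n → ℂ)) := by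
    have := vectorField_eq i f hm
    rw [affineCoord_affinePoint] at this
    exact this
  rw [coordComponents, h1]
  have h2 : mfderiv 𝓘(ℂ, Fin n → ℂ) 𝓘(ℂ, Fin n → ℂ)
      (affineChart i ∘ (affineChart i).symm) u = ContinuousLinearMap.id ℂ _ := by
    have : (affineChart i ∘ (affineChart i).symm : (Fin n → ℂ) → Fin n → ℂ) = id :=
      funext fun u => affineCoord_affinePoint i u
    rw [this]
    exact mfderiv_id
  have h3 := mfderiv_comp (g := affineChart i) (f := (affineChart i).symm) u
    ((contMDiffAt_affineChart i hm).mdifferentiableAt (by simp))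
    ((contMDiff_affineChart_symm i).contMDiffAt.mdifferentiableAt (by simp))
  exact congrArg (fun T : (Fin n → ℂ) →L[ℂ] (Fin n → ℂ) => T (f u)) (h3.symm.trans h2)

end ProjSpace

/-! ### Controllable jets: genericity and trivial stabilizers -/

namespace SecondProlongation

variable {n : ℕ}

/-- The affine vector field `u ↦ z + B (u - y)` realizes any prescribed 1-jet at `y`. Density needs
this: a polynomial that vanishes on all jets over a chart is then zero. -/
theorem exists_coord_eq (i : Fin (n + 1)) (c : CoordIndex n → ℂ) :
    ∃ q : SecondProlongation n, q.proj ∈ ProjSpace.affineOpen i ∧ coord i q = c := by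
  let y : Fin n → ℂ := fun j => c (.y j)
  let z : Fin n → ℂ := fun j => c (.z j)
  let B : (Fin n → ℂ) →L[ℂ] (Fin n → ℂ) := LinearMap.toContinuousLinearMap
    (Matrix.toLin' (Matrix.of fun j₂ j₁ => c (.w j₁ j₂)))
  let f : (Fin n → ℂ) → Fin n → ℂ := fun u => z + B (u - y)
  have hf : ContDiff ℂ ω f := contDiff_const.add (B.contDiff.comp (contDiff_id.sub contDiff_const))
  have hm := ProjSpace.affinePoint_mem i y
  let s : HolVectorFieldGerm (Fin n → ℂ) (ProjSpace n) :=
    { base := ProjSpace.affinePoint i y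
      field := ProjSpace.vectorField i f
      proj_field := fun _ => rfl
      holo := ProjSpace.contMDiffAt_vectorField i hf hm }
  have hcomp : components i s = f := ProjSpace.coordComponents_vectorField i f
  have hbase : ProjSpace.affineCoord i s.base = y := ProjSpace.affineCoord_affinePoint i y
  have hB : HasFDerivAt f B y := by
    have := (B.hasFDerivAt.comp y ((hasFDerivAt_id y).sub_const y)).const_add z
    rwa [ContinuousLinearMap.comp_id] at this
  refine ⟨OneJetTangent.mk s, hm, funext fun k => ?_⟩
  refine (if_pos hm).trans ?_
  cases k with
  | y j => exact congrFun hbase j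
  | z j =>
    change components i s (ProjSpace.affineCoord i s.base) j = _
    rw [hcomp, hbase]
    simp [f, z]
  | w j₁ j₂ =>
    change fderiv ℂ (components i s) (ProjSpace.affineCoord i s.base) (Pi.single j₁ 1) j₂ = _
    rw [hcomp, hbase, hB.fderiv]
    simp [B]

/-- The determinant of the Krylov matrix as a polynomial in the natural coordinates. -/
def krylovPoly (n : ℕ) : MvPolynomial (CoordIndex n) ℂ :=
  (krylovMatrix (Matrix.of fun j₂ j₁ => MvPolynomial.X (.w j₁ j₂))
    (fun j => MvPolynomial.X (.z j))).det

theorem eval_krylovPoly (c : CoordIndex n → ℂ) :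
    MvPolynomial.eval c (krylovPoly n) =
      (krylovMatrix (Matrix.of fun j₂ j₁ => c (.w j₁ j₂)) (fun j => c (.z j))).det := by
  rw [krylovPoly, RingHom.map_det]
  congr 1
  ext j k
  simp only [krylovMatrix, RingHom.mapMatrix_apply, Matrix.map_apply, Matrix.of_apply]
  rw [RingHom.map_mulVec, ← RingHom.mapMatrix_apply, map_pow]
  have hB : (MvPolynomial.eval c).mapMatrix (Matrix.of fun j₂ j₁ : Fin n =>
      MvPolynomial.X (CoordIndex.w j₁ j₂)) = Matrix.of fun j₂ j₁ => c (.w j₁ j₂) := by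
    ext
    simp
  have ha : (MvPolynomial.eval c ∘ fun j : Fin n => MvPolynomial.X (CoordIndex.z j)) =
      fun j => c (.z j) := by
    funext
    simp
  rw [hB, ha]

theorem krylovPoly_ne_zero (n : ℕ) : krylovPoly n ≠ 0 := by
  obtain ⟨B, a, h⟩ := exists_det_krylovMatrix_ne_zero (K := ℂ) n
  intro h0
  apply h
  have := eval_krylovPoly (n := n) fun
    | .y _ => 0
    | .z j => a j
    | .w j₁ j₂ => B j₂ j₁
  rw [h0, map_zero] at this
  exact this.symm

/-- The jet is controllable in the affine chart `i`: its value is a cyclic vector for its matrix of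
first derivatives. -/
def IsControllable (i : Fin (n + 1)) (q : SecondProlongation n) : Prop :=
  IsCyclicVector (Matrix.toLin' (derivMatrix i q)) (valueVec i q)

theorem isControllable_iff_eval_ne_zero (i : Fin (n + 1)) (q : SecondProlongation n) :
    IsControllable i q ↔ MvPolynomial.eval (coord i q) (krylovPoly n) ≠ 0 := by
  rw [IsControllable, isCyclicVector_iff_det_krylovMatrix_ne_zero, eval_krylovPoly]
  rfl

/-- A change of affine chart is the action formula for `g = 1`, hence a feedback transformation.
Both charts are compared with the chart `m` that the formula supplies. -/
theorem isControllable_iff_of_mem {i k : Fin (n + 1)} {q : SecondProlongation n}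
    (hi : q.proj ∈ ProjSpace.affineOpen i) (hk : q.proj ∈ ProjSpace.affineOpen k) :
    IsControllable i q ↔ IsControllable k q := by
  obtain ⟨m, -, h⟩ := exists_action_formula 1 q
  have e : ((1 : SL(n + 1, ℂ)) : PSL(n + 1, ℂ)) • q = q := one_smul PSL(n + 1, ℂ) q
  rw [e] at h
  have key : ∀ k, q.proj ∈ ProjSpace.affineOpen k → (IsControllable k q ↔ IsControllable m q) := by
    intro k hk
    obtain ⟨T, β, c, -, ha, hB, -⟩ := h k hk
    exact isCyclicVector_iff_of_feedback T β (β (valueVec m q)) ha hB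
  rw [key i hi, key k hk]

/-- The jets that are controllable in the affine charts around their base point. -/
def controllableSet (n : ℕ) : Set (SecondProlongation n) :=
  {q | ∀ i, q.proj ∈ ProjSpace.affineOpen i → IsControllable i q}

theorem mem_controllableSet_iff {i : Fin (n + 1)} {q : SecondProlongation n}
    (hi : q.proj ∈ ProjSpace.affineOpen i) : q ∈ controllableSet n ↔ IsControllable i q :=
  ⟨fun h => h i hi, fun h _ hk => (isControllable_iff_of_mem hi hk).1 h⟩

theorem isZariskiClosed_iff_isClosed (Z : Set (SecondProlongation n)) :
    @IsClosed _ (zariskiTopology n) Z ↔ IsZariskiClosed Z := by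
  rw [← @isOpen_compl_iff _ _ (zariskiTopology n)]
  change Zᶜᶜ ∈ {Z | IsZariskiClosed Z} ↔ _
  rw [compl_compl]
  rfl

theorem isOpen_controllableSet (n : ℕ) :
    @IsOpen _ (zariskiTopology n) (controllableSet n) := by
  let _ := zariskiTopology n
  rw [← isClosed_compl_iff, isZariskiClosed_iff_isClosed]
  refine fun i => ⟨{krylovPoly n}, fun q hq => ?_⟩
  rw [Set.mem_compl_iff, mem_controllableSet_iff hq, isControllable_iff_eval_ne_zero]
  simp

/-- If `f` vanishes on the controllable jets over a chart, then `f * krylovPoly n` vanishes at every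
coordinate vector. Polynomials over `ℂ` form a domain, so `f = 0`. -/
theorem dense_controllableSet (n : ℕ) :
    @Dense _ (zariskiTopology n) (controllableSet n) := by
  let _ := zariskiTopology n
  rw [dense_iff_closure_eq, Set.eq_univ_iff_forall]
  intro q
  obtain ⟨i, hi⟩ := ProjSpace.exists_mem_affineOpen q.proj
  obtain ⟨I, hI⟩ := (isZariskiClosed_iff_isClosed _).1
    (isClosed_closure (s := controllableSet n)) i
  rw [hI q hi]
  intro f hf
  have h0 : f * krylovPoly n = 0 := by
    refine MvPolynomial.funext fun c => ?_
    obtain ⟨r, hr, rfl⟩ := exists_coord_eq i c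
    rw [map_mul, map_zero, mul_eq_zero, or_iff_not_imp_right]
    intro hne
    exact (hI r hr).1 (subset_closure ((mem_controllableSet_iff hr).2
      ((isControllable_iff_eval_ne_zero i r).2 hne))) f hf
  rw [(mul_eq_zero.1 h0).resolve_right (krylovPoly_ne_zero n), map_zero]

/-- Rigidity gives `T = 1` and `β = 0`. So `g` multiplies by `c` both the homogeneous vector of the
base point and the hyperplane `w i = 0`, which together span. -/
theorem stabilizer_eq_bot_of_mem {q : SecondProlongation n} (hq : q ∈ controllableSet n) :
    MulAction.stabilizer PSL(n + 1, ℂ) q = ⊥ := by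
  rw [eq_bot_iff]
  intro g hg
  induction g using QuotientGroup.induction_on with | H g =>
  rw [Subgroup.mem_bot]
  obtain ⟨i, hi, h⟩ := exists_action_formula g q
  have hgq : (g : PSL(n + 1, ℂ)) • q = q := hg
  rw [hgq] at h
  -- As `g • q = q`, the same chart serves for source and target.
  obtain ⟨T, β, c, -, ha, hB, h0, h1⟩ := h i hi
  obtain ⟨hT, hβ⟩ := IsCyclicVector.feedback_rigid (hq i hi) T β ha.symm hB
  have hlin : ∀ v : Fin n → ℂ, (g : Matrix (Fin (n + 1)) (Fin (n + 1)) ℂ).mulVec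
      (i.insertNth (0 : ℂ) v) = c • i.insertNth (0 : ℂ) v := by
    intro v
    have := h1 v
    rwa [ProjSpace.homogImageLinear_apply, hT, hβ, LinearMap.zero_apply, zero_smul,
      add_zero] at this
  have hscalar : Matrix.scalar (Fin (n + 1)) c = (g : Matrix (Fin (n + 1)) (Fin (n + 1)) ℂ) := by
    apply Matrix.toLin'.injective
    refine LinearMap.ext fun w => ?_
    have hw : w = w i • i.insertNth (1 : ℂ) (ProjSpace.affineCoord i q.proj) +
        i.insertNth (0 : ℂ) (fun j => w (i.succAbove j) -
          w i * ProjSpace.affineCoord i q.proj j) := by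
      funext k
      refine Fin.succAboveCases i ?_ (fun j => ?_) k <;> simp
    have e0 : (g : Matrix (Fin (n + 1)) (Fin (n + 1)) ℂ).mulVec
      (i.insertNth (1 : ℂ) (ProjSpace.affineCoord i q.proj)) =
        c • i.insertNth (1 : ℂ) (ProjSpace.affineCoord i q.proj) := h0
    have hgw : (g : Matrix (Fin (n + 1)) (Fin (n + 1)) ℂ).mulVec w = c • w := by
      conv_lhs => rw [hw]
      rw [Matrix.mulVec_add, Matrix.mulVec_smul, e0, hlin, smul_comm, ← smul_add, ← hw]
    rw [Matrix.toLin'_apply, Matrix.toLin'_apply, hgw]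
    funext k
    simp [Matrix.scalar_apply, Matrix.mulVec_diagonal]
  rw [QuotientGroup.eq_one_iff, Matrix.SpecialLinearGroup.mem_center_iff]
  -- It remains to see `c ^ (n + 1) = 1`, which is `det g = 1`.
  refine ⟨c, ?_, hscalar⟩
  have := congrArg Matrix.det hscalar
  rwa [g.det_coe, Matrix.scalar_apply, Matrix.det_diagonal, Finset.prod_const,
    Finset.card_univ] at this

end SecondProlongation
end

/-- For a generic point `q` of the second prolongation of projective space (i.e. for every `q` in a
dense Zariski open subset) the isotropy group of `q` in `PSL(n+1, ℂ)` is trivial. -/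
theorem mainTheorem6 (n : ℕ) :
    ∃ U : Set (SecondProlongation n),
      @IsOpen (SecondProlongation n) (SecondProlongation.zariskiTopology n) U ∧
      @Dense (SecondProlongation n) (SecondProlongation.zariskiTopology n) U ∧
      ∀ q ∈ U, MulAction.stabilizer PSL(n + 1, ℂ) q = ⊥ := by
  exact ⟨SecondProlongation.controllableSet n, SecondProlongation.isOpen_controllableSet n,
    SecondProlongation.dense_controllableSet n,
    fun _ hq => SecondProlongation.stabilizer_eq_bot_of_mem hq⟩
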